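/- Let $\mathbb{K}$ be a field of characteristic $0$ and let $D$ be the $n$-th Weyl algebra over $\mathbb{K}$, i.e. the ring of $\mathbb{K}$-linear partial differential operators with coefficients in $\mathbb{K}[x_1,\dots,x_n]$. Every $P\in D$ is uniquely a finite sum $P=\sum_{\alpha,\beta\in\mathbb{N}^n} a_{\alpha\beta}\,x^\alpha\partial^\beta$ with $a_{\alpha\beta}\in\mathbb{K}$. Let $0\neq w\in\mathbb{R}^n_{\ge 0}$, let $F\subseteq\mathbb{R}$ be a subfield containing $w_1,\dots,w_n$, and fix a field homomorphism $F\to\mathbb{K}$, through which the $w_i$ are regarded as elements of $\mathbb{K}$ (for instance $F=\mathbb{Q}$ if $w$ is rational, or $F=\mathbb{R}\subseteq\mathbb{K}$). Put $s:=\sum_{i=1}^n w_i x_i\partial_i\in D$ and let $\mathbb{K}[s]\subseteq D$ be the subalgebra of polynomials in $s$. For $0\ne P\in D$ let $\sigma^V(P)$ be the sum of the terms $a_{\alpha\beta}x^\alpha\partial^\beta$ of $P$ for which the weight $-\sum_i w_i\alpha_i+\sum_i w_i\beta_i$ is maximal among all $(\alpha,\beta)$ with $a_{\alpha\beta}\neq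 0$, and put $\sigma^V(0)=0$. For a left ideal $I\subseteq D$ let $\operatorname{gr}^V(I)\subseteq D$ be the $\mathbb{K}$-linear span of $\{\sigma^V(P)\mid P\in I\}$; in particular $\operatorname{gr}^V(D)=D$. Let $I\subseteq D$ be a holonomic left ideal: $D/I$ is zero or has dimension $n$, the dimension being the degree of its Hilbert polynomial, which is the polynomial that agrees for large $k$ with $k\mapsto\dim_{\mathbb{K}} F_k/(F_k\cap I)$, where $F_k$ is spanned by the $x^\alpha\partial^\beta$ with $|\alpha|+|\beta|\le k$. Then, for every polynomial $q$ in one variable over $\mathbb{K}$, $$\bigl(\operatorname{gr}^V(I)+D\,q(s)\bigr)\cap\mathbb{K}[s]=\bigl(\operatorname{gr}^V(I)\cap\mathbb{K}[s]\bigr)+\mathbb{K}[s]\,q(s).$$ -/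

import Mathlib

noncomputable section

namespace Weyl

open MvPolynomial

variable (K : Type*) [Field K] (n : ℕ)

/-- The `n`-th Weyl algebra `D = D_n`: the `K`-algebra of linear partial differential operators with
coefficients in `K[x_1, …, x_n]`, i.e. the subalgebra of the `K`-linear endomorphisms of
`K[x_1, …, x_n]` generated by the multiplications by the variables and the partial derivatives. -/
def weylSubalgebra : Subalgebra K (Module.End K (MvPolynomial (Fin n) K)) :=
  Algebra.adjoin K
    (Set.range (fun i : Fin n => LinearMap.mulLeft K (X i : MvPolynomial (Fin n) K)) ∪
      Set.range (fun i : Fin n =>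
        ((pderiv i : Derivation K (MvPolynomial (Fin n) K) (MvPolynomial (Fin n) K)) :
          MvPolynomial (Fin n) K →ₗ[K] MvPolynomial (Fin n) K)))

/-- The `n`-th Weyl algebra, as a type. Its left ideals are the terms of `Ideal (D K n)`. -/
def D : Type _ := weylSubalgebra K n

instance : Ring (D K n) := inferInstanceAs (Ring (weylSubalgebra K n))

instance : Algebra K (D K n) := inferInstanceAs (Algebra K (weylSubalgebra K n))

variable {K n}

/-- The action of a differential operator on polynomials. -/
def act : D K n →ₐ[K] Module.End K (MvPolynomial (Fin n) K) := (weylSubalgebra K n).val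

lemma act_injective : Function.Injective (act : D K n → _) := Subtype.val_injective

/-- The operator `x_i` of multiplication by the `i`-th variable. -/
def x (i : Fin n) : D K n :=
  ⟨LinearMap.mulLeft K (X i), Algebra.subset_adjoin (Or.inl ⟨i, rfl⟩)⟩

/-- The partial derivative `∂_i`. -/
def d (i : Fin n) : D K n :=
  ⟨(pderiv i : Derivation K (MvPolynomial (Fin n) K) (MvPolynomial (Fin n) K)),
    Algebra.subset_adjoin (Or.inr ⟨i, rfl⟩)⟩

/-- `x^α = x_1^{α_1} ⋯ x_n^{α_n}`. -/
def xPow (α : Fin n →₀ ℕ) : D K n := ((List.finRange n).map fun i => x i ^ α i).prod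

/-- `∂^β = ∂_1^{β_1} ⋯ ∂_n^{β_n}`. -/
def dPow (β : Fin n →₀ ℕ) : D K n := ((List.finRange n).map fun i => d i ^ β i).prod

variable (K) in
/-- The normally ordered monomial `x^α ∂^β`, for a pair of exponents `m = (α, β)`. -/
def mono (m : (Fin n →₀ ℕ) × (Fin n →₀ ℕ)) : D K n := xPow m.1 * dPow m.2

/-! The normally ordered monomials form a `K`-basis of `D` in characteristic `0`. -/

@[simp] lemma x_apply (i : Fin n) (f : MvPolynomial (Fin n) K) :
    act (x i : D K n) f = X i * f := rfl

@[simp] lemma d_apply (i : Fin n) (f : MvPolynomial (Fin n) K) :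
    act (d i : D K n) f = pderiv i f := rfl

lemma mul_apply' (P Q : D K n) (f : MvPolynomial (Fin n) K) :
    act (P * Q) f = act P (act Q f) := by rw [map_mul]; rfl

lemma x_pow_apply (i : Fin n) (k : ℕ) (f : MvPolynomial (Fin n) K) :
    act ((x i : D K n) ^ k) f = X i ^ k * f := by
  induction k with
  | zero => simp
  | succ k ih => rw [pow_succ', mul_apply', ih, x_apply, pow_succ']; ring

lemma xList_apply (l : List (Fin n)) (α : Fin n →₀ ℕ) (f : MvPolynomial (Fin n) K) :
    act ((l.map fun i => (x i : D K n) ^ α i).prod) f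
      = (l.map fun i => (X i : MvPolynomial (Fin n) K) ^ α i).prod * f := by
  induction l with
  | nil => simp
  | cons i l ih =>
    rw [List.map_cons, List.prod_cons, mul_apply', ih, x_pow_apply, List.map_cons, List.prod_cons]
    ring

lemma xPow_apply (α : Fin n →₀ ℕ) (f : MvPolynomial (Fin n) K) :
    act (xPow α : D K n) f = monomial α 1 * f := by
  rw [xPow, xList_apply, ← Fin.prod_univ_def, monomial_eq, Finsupp.prod_fintype _ _ (by simp)]
  simp

lemma d_pow_apply (i : Fin n) (k : ℕ) (γ : Fin n →₀ ℕ) (a : K) :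
    act ((d i : D K n) ^ k) (monomial γ a)
      = monomial (γ - Finsupp.single i k) (a * ((γ i).descFactorial k : K)) := by
  induction k with
  | zero => simp
  | succ k ih =>
    rw [pow_succ', mul_apply', ih, d_apply, pderiv_monomial, Nat.descFactorial_succ]
    congr 1
    · rw [tsub_tsub, ← Finsupp.single_add]
    · simp; ring

lemma dList_apply (l : List (Fin n)) (hl : l.Nodup) (β γ : Fin n →₀ ℕ) (a : K) :
    act ((l.map fun i => (d i : D K n) ^ β i).prod) (monomial γ a)
      = monomial (γ - (l.map fun i => Finsupp.single i (β i)).sum)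
          (a * (l.map fun i => ((γ i).descFactorial (β i) : K)).prod) := by
  induction l with
  | nil => simp
  | cons i l ih =>
    have hi : i ∉ l := (List.nodup_cons.1 hl).1
    have h0 : ∀ l' : List (Fin n), i ∉ l' →
        (l'.map fun j => Finsupp.single j (β j)).sum i = 0 := by
      intro l' h
      induction l' with
      | nil => simp
      | cons j l' ih' =>
        rw [List.mem_cons, not_or] at h
        rw [List.map_cons, List.sum_cons, Finsupp.add_apply, ih' h.2,
          Finsupp.single_eq_of_ne h.1]
    rw [List.map_cons, List.prod_cons, mul_apply', ih (List.nodup_cons.1 hl).2, d_pow_apply]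
    simp only [List.map_cons, List.prod_cons, List.sum_cons]
    congr 1
    · rw [tsub_tsub, add_comm]
    · rw [Finsupp.tsub_apply, h0 l hi]; simp; ring

lemma dPow_apply (β γ : Fin n →₀ ℕ) (a : K) :
    act (dPow β : D K n) (monomial γ a)
      = monomial (γ - β) (a * ∏ i, ((γ i).descFactorial (β i) : K)) := by
  rw [dPow, dList_apply _ (List.nodup_finRange n), ← Fin.prod_univ_def, ← Fin.sum_univ_def,
    Finsupp.univ_sum_single]

lemma D_ext {P Q : D K n} (h : ∀ γ a, act P (monomial γ a) = act Q (monomial γ a)) : P = Q :=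
  act_injective (MvPolynomial.linearMap_ext fun γ => LinearMap.ext fun a => h γ a)

lemma x_mul_xPow (i : Fin n) (α : Fin n →₀ ℕ) :
    (x i : D K n) * xPow α = xPow (α + Finsupp.single i 1) := by
  refine D_ext fun γ a => ?_
  rw [mul_apply', xPow_apply, xPow_apply, x_apply, X, ← mul_assoc, monomial_mul, add_comm]
  simp

lemma d_mul_dPow (i : Fin n) (β : Fin n →₀ ℕ) :
    (d i : D K n) * dPow β = dPow (β + Finsupp.single i 1) := by
  refine D_ext fun γ a => ?_
  rw [mul_apply', dPow_apply, dPow_apply, d_apply, pderiv_monomial, tsub_tsub]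
  congr 1
  set δ : Fin n →₀ ℕ := β + Finsupp.single i 1 with hδ
  have hi : δ i = β i + 1 := by simp [hδ]
  have : ∏ j ∈ Finset.univ.erase i, ((γ j).descFactorial (δ j) : K)
      = ∏ j ∈ Finset.univ.erase i, ((γ j).descFactorial (β j) : K) := by
    refine Finset.prod_congr rfl fun j hj => ?_
    rw [hδ, Finsupp.add_apply, Finsupp.single_eq_of_ne (Finset.ne_of_mem_erase hj), add_zero]
  rw [← Finset.prod_erase_mul _ (fun j => ((γ j).descFactorial (β j) : K)) (Finset.mem_univ i),
    ← Finset.prod_erase_mul _ (fun j => ((γ j).descFactorial (δ j) : K)) (Finset.mem_univ i),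
    this, hi, Nat.descFactorial_succ, Finsupp.tsub_apply, Nat.cast_mul]
  ring

lemma d_mul_xPow (i : Fin n) (α : Fin n →₀ ℕ) :
    (d i : D K n) * xPow α
      = xPow α * d i + (α i : K) • xPow (α - Finsupp.single i 1) := by
  refine act_injective (LinearMap.ext fun f => ?_)
  simp only [map_add, map_smul, LinearMap.add_apply, LinearMap.smul_apply, mul_apply', xPow_apply, d_apply, Derivation.leibniz, pderiv_monomial, smul_eq_mul]
  rw [← smul_mul_assoc, smul_monomial]
  simp
  ring

lemma span_mono : Submodule.span K (Set.range (mono K : _ → D K n)) = ⊤ := by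
  set S := Submodule.span K (Set.range (mono K : _ → D K n)) with hS
  have hmem : ∀ α β, (xPow α * dPow β : D K n) ∈ S := fun α β =>
    Submodule.subset_span ⟨(α, β), rfl⟩
  have hx : ∀ i, ∀ P ∈ S, x i * P ∈ S := by
    intro i P hP
    induction hP using Submodule.span_induction with
    | mem P h =>
      obtain ⟨m, rfl⟩ := h
      rw [mono, ← mul_assoc, x_mul_xPow]; exact hmem _ _
    | zero => simp
    | add P Q _ _ hP hQ => rw [mul_add]; exact add_mem hP hQ
    | smul c P _ hP => rw [mul_smul_comm]; exact S.smul_mem _ hP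
  have hd : ∀ i, ∀ P ∈ S, d i * P ∈ S := by
    intro i P hP
    induction hP using Submodule.span_induction with
    | mem P h =>
      obtain ⟨m, rfl⟩ := h
      rw [mono, ← mul_assoc, d_mul_xPow, add_mul, mul_assoc, d_mul_dPow, smul_mul_assoc]
      exact add_mem (hmem _ _) (S.smul_mem _ (hmem _ _))
    | zero => simp
    | add P Q _ _ hP hQ => rw [mul_add]; exact add_mem hP hQ
    | smul c P _ hP => rw [mul_smul_comm]; exact S.smul_mem _ hP
  have h1 : (1 : D K n) ∈ S := by
    have : (1 : D K n) = xPow 0 * dPow 0 := by simp [xPow, dPow]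
    rw [this]; exact hmem 0 0
  have key : ∀ P ∈ weylSubalgebra K n, ∀ R : D K n, act R = P → ∀ Q ∈ S, R * Q ∈ S := by
    intro P hP
    induction hP using Algebra.adjoin_induction with
    | mem P h =>
      intro R hR Q hQ
      rcases h with ⟨i, rfl⟩ | ⟨i, rfl⟩
      · rw [act_injective (hR.trans (rfl : _ = act (x i)))]; exact hx i Q hQ
      · rw [act_injective (hR.trans (rfl : _ = act (d i)))]; exact hd i Q hQ
    | algebraMap r =>
      intro R hR Q hQ
      rw [act_injective (hR.trans (AlgHom.commutes act r).symm), ← Algebra.smul_def]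
      exact S.smul_mem _ hQ
    | add P P' hP hP' h h' =>
      intro R hR Q hQ
      obtain ⟨A, rfl⟩ : ∃ A : D K n, act A = P := ⟨⟨P, hP⟩, rfl⟩
      obtain ⟨B, rfl⟩ : ∃ B : D K n, act B = P' := ⟨⟨P', hP'⟩, rfl⟩
      rw [act_injective (hR.trans (map_add act A B).symm), add_mul]
      exact add_mem (h A rfl Q hQ) (h' B rfl Q hQ)
    | mul P P' hP hP' h h' =>
      intro R hR Q hQ
      obtain ⟨A, rfl⟩ : ∃ A : D K n, act A = P := ⟨⟨P, hP⟩, rfl⟩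
      obtain ⟨B, rfl⟩ : ∃ B : D K n, act B = P' := ⟨⟨P', hP'⟩, rfl⟩
      rw [act_injective (hR.trans (map_mul act A B).symm), mul_assoc]
      exact h A rfl _ (h' B rfl Q hQ)
  rw [eq_top_iff]
  intro P _
  simpa using key (act P) P.2 P rfl 1 h1

lemma linearIndependent_mono [CharZero K] : LinearIndependent K (mono K : _ → D K n) := by
  classical
  rw [linearIndependent_iff]
  intro c hc
  by_contra hne
  have hsupp : (c.support.image Prod.snd).Nonempty := by
    simpa using Finsupp.support_nonempty_iff.2 hne
  obtain ⟨β, hβ, hmin⟩ := (c.support.image Prod.snd).exists_minimal hsupp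
  obtain ⟨⟨α, β'⟩, hm, rfl⟩ := Finset.mem_image.1 hβ
  dsimp only at hmin hβ
  have h : act (Finsupp.linearCombination K (mono K : _ → D K n) c) (monomial β' 1) = 0 := by
    rw [hc]; simp
  rw [Finsupp.linearCombination_apply, Finsupp.sum] at h
  have hcoe : ∀ s : Finset ((Fin n →₀ ℕ) × (Fin n →₀ ℕ)),
      act (∑ m ∈ s, c m • (mono K m : D K n)) (monomial β' 1)
        = ∑ m ∈ s, c m • (act (mono K m : D K n) (monomial β' 1)) := by
    intro s
    simp
  rw [hcoe] at h
  have h2 := congrArg (coeff α) h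
  rw [coeff_sum, Finset.sum_eq_single (α, β')] at h2
  · have hprod : ∏ j, ((β' j).descFactorial (β' j) : K) ≠ 0 :=
      Finset.prod_ne_zero_iff.2 fun j _ => by
        rw [Nat.descFactorial_self]; exact_mod_cast Nat.factorial_ne_zero _
    simp only [mono, mul_apply', dPow_apply, xPow_apply, monomial_mul, coeff_smul, coeff_monomial,
      tsub_self, add_zero, one_mul, if_true, smul_eq_mul, coeff_zero] at h2
    exact Finsupp.mem_support_iff.1 hm ((mul_eq_zero.1 h2).resolve_right hprod)
  · rintro ⟨α₁, β₁⟩ hm₁ hne₁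
    simp only [mono, mul_apply', dPow_apply, xPow_apply, monomial_mul, coeff_smul, coeff_monomial]
    by_cases hle : β₁ ≤ β'
    · have : β' ≤ β₁ := hmin (Finset.mem_image_of_mem Prod.snd hm₁) hle
      obtain rfl := le_antisymm hle this
      have : α₁ ≠ α := fun e => hne₁ (by rw [e])
      simp [this]
    · obtain ⟨i, hi⟩ := not_forall.1 (fun h => hle h)
      have : ∏ j, ((β' j).descFactorial (β₁ j) : K) = 0 :=
        Finset.prod_eq_zero (Finset.mem_univ i)
          (by rw [Nat.descFactorial_of_lt (not_le.1 hi), Nat.cast_zero])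
      simp [this]
  · intro h; exact absurd hm h

variable (K n) in
/-- The basis `(x^α ∂^β)` of `D`: every operator is uniquely `P = ∑ a_{αβ} x^α ∂^β`, and
`a_{αβ} = (monoBasis K n).repr P (α, β)`. -/
def monoBasis [CharZero K] : Module.Basis ((Fin n →₀ ℕ) × (Fin n →₀ ℕ)) K (D K n) :=
  Module.Basis.mk linearIndependent_mono span_mono.ge

/-- The Bernstein filtration: `F_k` is spanned by the `x^α ∂^β` with `|α| + |β| ≤ k`. -/
def bernstein (K : Type*) [Field K] (n k : ℕ) : Submodule K (D K n) :=
  Submodule.span K (mono K '' {m | (∑ i, m.1 i) + ∑ i, m.2 i ≤ k})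

/-- The Hilbert function `k ↦ dim_K F_k / (F_k ∩ I)` of `D / I`, the dimension of the image of `F_k`
in `D / I`. -/
def hilbertFunction (I : Ideal (D K n)) (k : ℕ) : ℕ :=
  Module.finrank K ((bernstein K n k).map (I.mkQ.restrictScalars K))

/-- A left ideal `I` of `D` is holonomic if `D / I` is a holonomic module: it is zero, or it has
dimension `n`, the dimension (Gelfand-Kirillov dimension) of `D / I` being the degree of its
Hilbert polynomial with respect to the Bernstein filtration. -/
def IsHolonomic (I : Ideal (D K n)) : Prop :=
  I = ⊤ ∨ ∃ p : Polynomial ℚ, p.natDegree = n ∧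
    ∀ᶠ k : ℕ in Filter.atTop, (hilbertFunction I k : ℚ) = p.eval (k : ℚ)

/-- The weight `-w α + w β` of the exponent `(α, β)`: `x_i` has weight `-w_i`, `∂_i` has `w_i`. -/
def weight (w : Fin n → ℝ) (m : (Fin n →₀ ℕ) × (Fin n →₀ ℕ)) : ℝ :=
  -(∑ i, w i * m.1 i) + ∑ i, w i * m.2 i

open Classical in
/-- The principal symbol `σ^V(P)` with respect to `w`: the part of
`P = ∑ a_{αβ} x^α ∂^β` made of the terms of maximal weight among the `(α, β)` with `a_{αβ} ≠ 0`. -/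
def symbol [CharZero K] (w : Fin n → ℝ) (P : D K n) : D K n :=
  ∑ m ∈ ((monoBasis K n).repr P).support with
      ∀ m' ∈ ((monoBasis K n).repr P).support, weight w m' ≤ weight w m,
    (monoBasis K n).repr P m • mono K m

/-- `gr^V(I) ⊆ gr^V(D) = D`: the `K`-span of the principal symbols of the elements of `I`. -/
def gr [CharZero K] (w : Fin n → ℝ) (I : Ideal (D K n)) : Submodule K (D K n) :=
  Submodule.span K (symbol w '' (I : Set (D K n)))

/-- The operator `s = ∑ c_i x_i ∂_i`, for coefficients `c` in `K`. -/
def sOp (c : Fin n → K) : D K n := ∑ i, c i • (x i * d i)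

/-- `K[s] ⊆ D`, the set of the polynomials in `s`. -/
def polys (s : D K n) : Submodule K (D K n) :=
  LinearMap.range (Polynomial.aeval (R := K) s).toLinearMap

/-- `K[s]⟨q⟩ = {h q | h ∈ K[s]}`, the ideal of `K[s]` generated by `q`, for `q ∈ K[s]`. -/
def polyMultiples (s q : D K n) : Submodule K (D K n) :=
  (polys s).map (LinearMap.mulRight K q)

end Weyl

end

/-! Write `J` for `gr^V(I)`. It is a left ideal, graded by weight, and stable under right
multiplication by `s`, since `G s = s G + u G` for `G` homogeneous of weight `u`
(`mul_weightOp_mem_gr`).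

The main point is that `J` contains some `b(s) ≠ 0` (`exists_aeval_mem_gr`). The Hilbert function of
`D/J` is at most that of `D/I` (`hilbertFunction_grIdeal_le`), so it is `O(k^n)`. Let `D ⊗ K[t]` act
on `D/J`, with `t` acting by right multiplication by `s`. If no `b(s) ≠ 0` lay in `J`, Bernstein's
commutator argument (`eq_zero_of_sum_mul_pow_mem`) would embed a space of operators of dimension at
least `m^(2n+1)` into a space of linear maps of dimension `O(m^(2n))`, which is absurd for large
`m`.

Now let `p(s) = G + R q(s)` with `G ∈ J`. As `p(s)` and `q(s)` have weight `0` and `J` is graded,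
`G` and `R` may be replaced by their components of weight `0`; then `R` commutes with `s`. What
remains is arithmetic in the principal ideal domain `K[t]` (`exists_dvd_sub`): if `g` generates the
nonzero ideal of all `f` with `f(s) ∈ J`, then `gcd(g, q)` divides `p`, and Bézout splits `p` into a
multiple of `g` and a multiple of `q`. -/

namespace Weyl

open MvPolynomial

/-! ### The Bernstein filtration: products, commutators, scalars. -/

section Bernstein

variable {K : Type*} [Field K] {n : ℕ}

lemma mono_mem_bernstein {k : ℕ} {m : (Fin n →₀ ℕ) × (Fin n →₀ ℕ)}
    (h : (∑ i, m.1 i) + ∑ i, m.2 i ≤ k) : mono K m ∈ bernstein K n k :=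
  Submodule.subset_span ⟨m, h, rfl⟩

lemma bernstein_le {k : ℕ} {S : Submodule K (D K n)}
    (h : ∀ α β : Fin n →₀ ℕ, (∑ i, α i) + ∑ i, β i ≤ k → xPow α * dPow β ∈ S) :
    bernstein K n k ≤ S := by
  refine Submodule.span_le.2 ?_
  rintro _ ⟨m, hm, rfl⟩
  exact h _ _ hm

lemma sum_add_single {n : ℕ} (α : Fin n →₀ ℕ) (i : Fin n) :
    ∑ j, (α + Finsupp.single i 1 : Fin n →₀ ℕ) j = (∑ j, α j) + 1 := by
  simp [Finset.sum_add_distrib, Finsupp.single_apply]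

lemma sum_tsub_single {n : ℕ} {α : Fin n →₀ ℕ} {i : Fin n} (h : α i ≠ 0) :
    ∑ j, (α - Finsupp.single i 1 : Fin n →₀ ℕ) j + 1 = ∑ j, α j := by
  have hle : Finsupp.single i 1 ≤ α := by
    rw [Finsupp.single_le_iff]; omega
  rw [← sum_add_single (α - Finsupp.single i 1) i, tsub_add_cancel_of_le hle]

lemma dPow_mul_x (i : Fin n) (β : Fin n →₀ ℕ) :
    (dPow β : D K n) * x i = x i * dPow β + (β i : K) • dPow (β - Finsupp.single i 1) := by
  induction hk : ∑ j, β j generalizing β with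
  | zero =>
    have : β = 0 := by
      ext j
      exact (Finset.sum_eq_zero_iff.1 hk) j (Finset.mem_univ j)
    subst this
    simp [dPow]
  | succ k ih =>
    obtain ⟨j, hj⟩ : ∃ j, β j ≠ 0 := by
      by_contra! h
      simp [h] at hk
    have hβ : (β - Finsupp.single j 1) + Finsupp.single j 1 = β :=
      tsub_add_cancel_of_le (by rw [Finsupp.single_le_iff]; omega)
    have hs := sum_tsub_single hj
    set γ := β - Finsupp.single j 1 with hγ
    have hdx : (d j : D K n) * x i = x i * d j + (if i = j then 1 else 0) := by
      refine act_injective (LinearMap.ext fun f => ?_)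
      by_cases h : i = j
      · subst h; simp
      · simp [h, pderiv_X_of_ne h]
    rw [← hβ, ← d_mul_dPow, mul_assoc, ih γ (by omega), mul_add, ← mul_assoc, hdx, add_mul,
      mul_assoc, add_assoc, mul_smul_comm, d_mul_dPow, d_mul_dPow]
    congr 1
    by_cases h : i = j
    · subst h
      by_cases h0 : γ i = 0
      · simp [h0]
      · have : γ - Finsupp.single i 1 + Finsupp.single i 1 = γ :=
          tsub_add_cancel_of_le (by rw [Finsupp.single_le_iff]; omega)
        rw [this]
        simp [add_smul, add_comm]
    · have h1 : γ - Finsupp.single i 1 + Finsupp.single j 1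
          = γ + Finsupp.single j 1 - Finsupp.single i 1 := by
        ext l
        simp only [Finsupp.add_apply, Finsupp.tsub_apply, Finsupp.single_apply]
        split_ifs <;> omega
      rw [h1]
      simp [h]

lemma x_mul_mem {i : Fin n} {k : ℕ} {P : D K n} (hP : P ∈ bernstein K n k) :
    x i * P ∈ bernstein K n (k + 1) := by
  refine bernstein_le (S := (bernstein K n (k + 1)).comap (LinearMap.mulLeft K (x i))) ?_ hP
  intro α β h
  rw [Submodule.mem_comap, LinearMap.mulLeft_apply, ← mul_assoc, x_mul_xPow]
  refine mono_mem_bernstein (m := (_, _)) ?_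
  rw [sum_add_single]; dsimp only; omega

lemma bernstein_mono {k l : ℕ} (h : k ≤ l) : bernstein K n k ≤ bernstein K n l :=
  Submodule.span_mono (Set.image_mono fun _ hm => le_trans hm h)

lemma d_mul_mem {i : Fin n} {k : ℕ} {P : D K n} (hP : P ∈ bernstein K n k) :
    d i * P ∈ bernstein K n (k + 1) := by
  refine bernstein_le (S := (bernstein K n (k + 1)).comap (LinearMap.mulLeft K (d i))) ?_ hP
  intro α β h
  rw [Submodule.mem_comap, LinearMap.mulLeft_apply, ← mul_assoc, d_mul_xPow, add_mul, mul_assoc,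
    d_mul_dPow, smul_mul_assoc]
  refine add_mem (mono_mem_bernstein (m := (_, _)) ?_) ?_
  · rw [sum_add_single]; dsimp only; omega
  · by_cases h0 : α i = 0
    · simp [h0]
    · refine Submodule.smul_mem _ _ (mono_mem_bernstein (m := (_, _)) ?_)
      have := sum_tsub_single h0
      dsimp only; omega

/-- Left multiplication by one letter `x i` or `d i` raises the degree by at most one, so a normally
ordered monomial can be applied letter by letter. -/
lemma mul_mem_bernstein {k l : ℕ} {P Q : D K n} (hP : P ∈ bernstein K n k)
    (hQ : Q ∈ bernstein K n l) : P * Q ∈ bernstein K n (k + l) := by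
  have hx : ∀ (i : Fin n) (e k : ℕ) (R : D K n), R ∈ bernstein K n k →
      x i ^ e * R ∈ bernstein K n (e + k) := by
    intro i e k R hR
    induction e with
    | zero => simpa using hR
    | succ e ih =>
      rw [pow_succ', mul_assoc]
      exact bernstein_mono (by omega) (x_mul_mem ih)
  have hd : ∀ (i : Fin n) (e k : ℕ) (R : D K n), R ∈ bernstein K n k →
      d i ^ e * R ∈ bernstein K n (e + k) := by
    intro i e k R hR
    induction e with
    | zero => simpa using hR
    | succ e ih =>
      rw [pow_succ', mul_assoc]
      exact bernstein_mono (by omega) (d_mul_mem ih)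
  have hlist : ∀ (y : Fin n → D K n) (_ : ∀ (i : Fin n) (e k : ℕ) (R : D K n),
      R ∈ bernstein K n k → y i ^ e * R ∈ bernstein K n (e + k)) (α : Fin n →₀ ℕ)
      (L : List (Fin n)) (k : ℕ) (R : D K n), R ∈ bernstein K n k →
      (L.map fun i => y i ^ α i).prod * R ∈ bernstein K n ((L.map fun i => α i).sum + k) := by
    intro y hy α L k R hR
    induction L with
    | nil => simpa using hR
    | cons i L ih =>
      simp only [List.map_cons, List.prod_cons, List.sum_cons, mul_assoc, add_assoc]
      exact hy _ _ _ _ ih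
  refine bernstein_le (S := (bernstein K n (k + l)).comap (LinearMap.mulRight K Q)) ?_ hP
  intro α β h
  rw [Submodule.mem_comap, LinearMap.mulRight_apply, mul_assoc]
  refine bernstein_mono ?_ (hlist x hx α (List.finRange n) _ _
    (hlist d hd β (List.finRange n) _ _ hQ))
  rw [← Fin.sum_univ_def, ← Fin.sum_univ_def]
  omega

lemma one_mem_bernstein (k : ℕ) : (1 : D K n) ∈ bernstein K n k := by
  have : (1 : D K n) = mono K 0 := by simp [mono, xPow, dPow]
  rw [this]
  exact mono_mem_bernstein (by simp)

lemma x_mem_bernstein (i : Fin n) : (x i : D K n) ∈ bernstein K n 1 := by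
  simpa using x_mul_mem (i := i) (one_mem_bernstein (K := K) (n := n) 0)

lemma d_mem_bernstein (i : Fin n) : (d i : D K n) ∈ bernstein K n 1 := by
  simpa using d_mul_mem (i := i) (one_mem_bernstein (K := K) (n := n) 0)

lemma pow_mem_bernstein {k : ℕ} {P : D K n} (hP : P ∈ bernstein K n k) (i : ℕ) :
    P ^ i ∈ bernstein K n (i * k) := by
  induction i with
  | zero => simpa using one_mem_bernstein 0
  | succ i ih =>
    rw [pow_succ, add_mul, one_mul]
    exact mul_mem_bernstein ih hP

lemma mem_bernstein_zero {P : D K n} (hP : P ∈ bernstein K n 0) :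
    ∃ c : K, P = algebraMap K (D K n) c := by
  refine bernstein_le (S := LinearMap.range (Algebra.linearMap K (D K n))) ?_ hP |>.imp
    fun c h => h.symm
  intro α β h
  have hα : α = 0 := by
    ext j
    exact Finset.sum_eq_zero_iff.1 (by omega : ∑ i, α i = 0) j (Finset.mem_univ j)
  have hβ : β = 0 := by
    ext j
    exact Finset.sum_eq_zero_iff.1 (by omega : ∑ i, β i = 0) j (Finset.mem_univ j)
  subst hα hβ
  exact ⟨1, by simp [xPow, dPow]⟩

/-- Bracketing with `x i` differentiates formally in `∂_i`, so the degree drops by one;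
multiplicativity of the filtration alone would not give this. In `commutator_d_mem` the roles of `x`
and `∂` are exchanged, up to sign. -/
lemma commutator_x_mem {i : Fin n} {k : ℕ} {P : D K n} (hP : P ∈ bernstein K n (k + 1)) :
    P * x i - x i * P ∈ bernstein K n k := by
  refine bernstein_le (S := (bernstein K n k).comap
    (LinearMap.mulRight K (x i) - LinearMap.mulLeft K (x i))) ?_ hP
  intro α β h
  rw [Submodule.mem_comap, LinearMap.sub_apply, LinearMap.mulRight_apply, LinearMap.mulLeft_apply]
  have hc : (xPow α : D K n) * x i = x i * xPow α := by
    refine act_injective (LinearMap.ext fun f => ?_)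
    simp only [mul_apply', xPow_apply, x_apply]
    ring
  rw [mul_assoc, dPow_mul_x, mul_add, ← mul_assoc, hc, ← mul_assoc, add_sub_cancel_left,
    mul_smul_comm]
  by_cases h0 : β i = 0
  · simp [h0]
  · refine Submodule.smul_mem _ _ (mono_mem_bernstein (m := (_, _)) ?_)
    have := sum_tsub_single h0
    dsimp only; omega

lemma commutator_d_mem {i : Fin n} {k : ℕ} {P : D K n} (hP : P ∈ bernstein K n (k + 1)) :
    P * d i - d i * P ∈ bernstein K n k := by
  refine bernstein_le (S := (bernstein K n k).comap
    (LinearMap.mulRight K (d i) - LinearMap.mulLeft K (d i))) ?_ hP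
  intro α β h
  rw [Submodule.mem_comap, LinearMap.sub_apply, LinearMap.mulRight_apply, LinearMap.mulLeft_apply]
  have hc : (dPow β : D K n) * d i = d i * dPow β := by
    refine D_ext fun γ a => ?_
    rw [d_mul_dPow, add_comm, mul_apply', d_apply, pderiv_monomial, dPow_apply, dPow_apply,
      tsub_tsub]
    congr 1
    rw [mul_assoc]
    congr 1
    rw [← Finset.mul_prod_erase _ (fun j => ((γ j).descFactorial
          ((Finsupp.single i 1 + β : Fin n →₀ ℕ) j) : K)) (Finset.mem_univ i),
      ← Finset.mul_prod_erase _ (fun j => (((γ - Finsupp.single i 1 : Fin n →₀ ℕ) j).descFactorial (β j) : K))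
        (Finset.mem_univ i), ← mul_assoc]
    congr 1
    · rw [Finsupp.add_apply, Finsupp.tsub_apply, Finsupp.single_eq_same, add_comm 1]
      -- The truncated exponent `0 - 1` does no harm: at `γ i = 0` both sides vanish.
      cases γ i with
      | zero => simp
      | succ g => rw [Nat.succ_descFactorial_succ]; push_cast; simp
    · refine Finset.prod_congr rfl fun j hj => ?_
      have hj := Finset.ne_of_mem_erase hj
      simp [Finsupp.single_eq_of_ne hj]
  rw [mul_assoc, hc, ← mul_assoc, ← mul_assoc, d_mul_xPow, add_mul, sub_add_cancel_left,
    smul_mul_assoc]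
  refine neg_mem ?_
  by_cases h0 : α i = 0
  · simp [h0]
  · refine Submodule.smul_mem _ _ (mono_mem_bernstein (m := (_, _)) ?_)
    have := sum_tsub_single h0
    dsimp only; omega

/-- Commuting with all `∂_i` makes all derivatives of `P • 1` vanish, so `P • 1` is a constant `c`
in characteristic `0`; commuting with the `x_i` then gives `P • f = c f`. -/
lemma exists_algebraMap_of_commute [CharZero K] {P : D K n} (hx : ∀ i, P * x i = x i * P)
    (hd : ∀ i, P * d i = d i * P) : ∃ c : K, P = algebraMap K (D K n) c := by
  have h1 : ∀ i, pderiv i (act P 1) = 0 := by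
    intro i
    rw [← d_apply, ← mul_apply', ← hd, mul_apply', d_apply]
    simp
  have h2 : act P 1 = C (coeff 0 (act P 1)) := by
    ext m
    rw [coeff_C]
    split_ifs with h
    · rw [h]
    · obtain ⟨i, hi⟩ : ∃ i, m i ≠ 0 := by
        by_contra! h'
        exact h (Finsupp.ext fun i => (h' i).symm)
      have h3 := congrArg (coeff (m - Finsupp.single i 1)) (h1 i)
      rw [coeff_pderiv, tsub_add_cancel_of_le (by rw [Finsupp.single_le_iff]; omega), coeff_zero]
        at h3
      refine (mul_eq_zero.1 h3).resolve_right ?_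
      exact_mod_cast Nat.succ_ne_zero ((m - (Finsupp.single i 1 : Fin n →₀ ℕ)) i)
  refine ⟨coeff 0 (act P 1), act_injective (LinearMap.ext fun f => ?_)⟩
  rw [AlgHom.commutes, Module.algebraMap_end_apply, smul_eq_C_mul, ← h2]
  induction f using MvPolynomial.induction_on with
  | C a => rw [← mul_one (C a), ← smul_eq_C_mul, map_smul, mul_smul_comm, mul_one]
  | add p q hp hq => rw [map_add, hp, hq, mul_add]
  | mul_X p i hp =>
    rw [mul_comm p, ← x_apply, ← mul_apply', hx, mul_apply', hp, x_apply, x_apply]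
    ring

instance finite_bernstein (k : ℕ) : Module.Finite K (bernstein K n k) := by
  refine Module.Finite.span_of_finite K (Set.Finite.image _ ?_)
  refine (Set.finite_Iic ((Finsupp.equivFunOnFinite.symm fun _ => k,
    Finsupp.equivFunOnFinite.symm fun _ => k) : (Fin n →₀ ℕ) × (Fin n →₀ ℕ))).subset ?_
  rintro ⟨α, β⟩ h
  have hα : ∀ i, α i ≤ k := fun i =>
    (Finset.single_le_sum (fun j _ => Nat.zero_le (α j)) (Finset.mem_univ i)).trans
      (le_trans (Nat.le_add_right _ _) h)
  have hβ : ∀ i, β i ≤ k := fun i =>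
    (Finset.single_le_sum (fun j _ => Nat.zero_le (β j)) (Finset.mem_univ i)).trans
      (le_trans (Nat.le_add_left _ _) h)
  exact ⟨fun i => by simpa using hα i, fun i => by simpa using hβ i⟩

/-- The exponents with all entries at most `m`. -/
noncomputable def boxExp {n m : ℕ} (a : (Fin n → Fin (m + 1)) × (Fin n → Fin (m + 1))) :
    (Fin n →₀ ℕ) × (Fin n →₀ ℕ) :=
  (Finsupp.equivFunOnFinite.symm fun i => (a.1 i : ℕ),
    Finsupp.equivFunOnFinite.symm fun i => (a.2 i : ℕ))

lemma boxExp_injective {n m : ℕ} : Function.Injective (boxExp (n := n) (m := m)) := by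
  rintro ⟨a, b⟩ ⟨a', b'⟩ h
  simp only [boxExp, Prod.mk.injEq, EmbeddingLike.apply_eq_iff_eq] at h
  refine Prod.ext (funext fun i => Fin.ext ?_) (funext fun i => Fin.ext ?_)
  · exact congrFun h.1 i
  · exact congrFun h.2 i

lemma mono_boxExp_mem {n m : ℕ} (a : (Fin n → Fin (m + 1)) × (Fin n → Fin (m + 1))) :
    mono K (boxExp a) ∈ bernstein K n ((2 * n + 1) * m) := by
  refine mono_mem_bernstein ?_
  have h1 : ∑ i, (boxExp a).1 i ≤ n * m := by
    simpa using Finset.sum_le_card_nsmul Finset.univ (fun i => (boxExp a).1 i) m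
      (fun i _ => Nat.lt_succ_iff.1 (a.1 i).2)
  have h2 : ∑ i, (boxExp a).2 i ≤ n * m := by
    simpa using Finset.sum_le_card_nsmul Finset.univ (fun i => (boxExp a).2 i) m
      (fun i _ => Nat.lt_succ_iff.1 (a.2 i).2)
  calc _ ≤ n * m + n * m := add_le_add h1 h2
    _ ≤ (2 * n + 1) * m := by nlinarith

end Bernstein

/-! ### Bernstein's dimension count and the existence of `b(s)`. -/

section Counting

variable {K : Type*} [Field K] [CharZero K] {n : ℕ}

/-- Bernstein's nondegeneracy argument for the action of `D ⊗ K[t]` on `D / J`, where `t` acts by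
right multiplication by `s`. -/
lemma eq_zero_of_sum_mul_pow_mem {J : Ideal (D K n)} {s : D K n}
    (hJ : ∀ b : Polynomial K, Polynomial.aeval s b ∈ J → b = 0) {L : ℕ} (k : ℕ)
    (Q : Fin L → D K n) (hQ : ∀ i, Q i ∈ bernstein K n k)
    (h : ∀ P ∈ bernstein K n k, ∑ i, Q i * P * s ^ (i : ℕ) ∈ J) : Q = 0 := by
  -- For scalar coefficients, `P = 1` yields a polynomial in `s` that lies in `J`, hence is zero.
  have key : ∀ (k : ℕ) (Q : Fin L → D K n), (∀ i, ∃ c : K, Q i = algebraMap K (D K n) c) →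
      (∀ P ∈ bernstein K n k, ∑ i, Q i * P * s ^ (i : ℕ) ∈ J) → Q = 0 := by
    intro k Q hQ h
    choose c hc using hQ
    have h1 := h 1 (one_mem_bernstein k)
    have h2 : ∑ i : Fin L, Polynomial.monomial (i : ℕ) (c i) = 0 := by
      apply hJ
      rw [map_sum]
      simpa [Polynomial.aeval_monomial, hc] using h1
    funext i
    have h3 := congrArg (fun p => Polynomial.coeff p (i : ℕ)) h2
    simp only [Polynomial.finsetSum_coeff, Polynomial.coeff_monomial, Polynomial.coeff_zero,
      Fin.val_inj, Finset.sum_ite_eq', Finset.mem_univ, if_true] at h3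
    rw [hc, h3, map_zero, Pi.zero_apply]
  induction k generalizing Q with
  | zero => exact key 0 Q (fun i => mem_bernstein_zero (hQ i)) h
  | succ k ih =>
    -- The commutators `[Q i, y]` have lower degree and satisfy the same hypothesis one step down,
    -- so they vanish by induction. With `y` running over the generators, the `Q i` are central,
    -- hence scalars.
    have hcomm : ∀ y : D K n, (∀ P ∈ bernstein K n k, y * P ∈ bernstein K n (k + 1)) →
        (∀ P ∈ bernstein K n (k + 1), P * y - y * P ∈ bernstein K n k) →
        ∀ i, Q i * y = y * Q i := by
      intro y hy hy' i
      have := ih (fun i => Q i * y - y * Q i) (fun i => hy' _ (hQ i)) (fun P hP => by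
        have e : ∑ i, (Q i * y - y * Q i) * P * s ^ (i : ℕ)
            = ∑ i, Q i * (y * P) * s ^ (i : ℕ) - y * ∑ i, Q i * P * s ^ (i : ℕ) := by
          rw [Finset.mul_sum, ← Finset.sum_sub_distrib]
          refine Finset.sum_congr rfl fun i _ => ?_
          noncomm_ring
        rw [e]
        exact sub_mem (h _ (hy P hP)) (J.mul_mem_left y (h P (bernstein_mono (Nat.le_succ k) hP))))
      exact sub_eq_zero.1 (congrFun this i)
    refine key (k + 1) Q (fun i => exists_algebraMap_of_commute
      (fun j => hcomm (x j) (fun P hP => x_mul_mem hP) (fun P hP => commutator_x_mem hP) i)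
      (fun j => hcomm (d j) (fun P hP => d_mul_mem hP) (fun P hP => commutator_d_mem hP) i)) h

/-- The left side counts the products of `x^α ∂^β`, all exponents at most `m`, with `t^i`, `i < m`.
They act as independent maps from the image of `F_k` in `D/J` to that of `F_l`. -/
lemma card_mul_le_hilbertFunction_mul {J : Ideal (D K n)} {s : D K n}
    (hs : s ∈ bernstein K n 2) (hJs : ∀ P ∈ J, P * s ∈ J)
    (hJ : ∀ b : Polynomial K, Polynomial.aeval s b ∈ J → b = 0) (m : ℕ) :
    (m + 1) ^ n * (m + 1) ^ n * m
      ≤ hilbertFunction J ((2 * n + 1) * m) * hilbertFunction J ((4 * n + 4) * m) := by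
  classical
  -- The monomials of the box have degree at most `2nm`; the extra `m` keeps `k ≥ m` even when `n =
  -- 0`. Since `s` has degree `2`, `l` is `2k + 2m`.
  set k := (2 * n + 1) * m with hk
  set l := (4 * n + 4) * m with hl
  set π : D K n →ₗ[K] (D K n ⧸ J) := J.mkQ.restrictScalars K with hπ
  have hπ0 : ∀ P, π P = 0 ↔ P ∈ J := fun P => Submodule.Quotient.mk_eq_zero J
  have hJpow : ∀ (i : ℕ), ∀ P ∈ J, P * s ^ i ∈ J := by
    intro i P hP
    induction i with
    | zero => simpa using hP
    | succ i ih => rw [pow_succ, ← mul_assoc]; exact hJs _ ih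
  let B := Module.finBasis K ((bernstein K n k).map π)
  have hB : ∀ j, ∃ P ∈ bernstein K n k, π P = B j := fun j => (B j).2
  choose p hp hpB using hB
  let E : Type := ((Fin n → Fin (m + 1)) × (Fin n → Fin (m + 1))) × Fin m
  have hmem : ∀ (e : E) j,
      mono K (boxExp e.1) * p j * s ^ (e.2 : ℕ) ∈ bernstein K n l := by
    intro e j
    refine bernstein_mono ?_ (mul_mem_bernstein
      (mul_mem_bernstein (mono_boxExp_mem e.1) (hp j)) (pow_mem_bernstein hs _))
    have := e.2.2
    rw [← hk, hl, hk]
    nlinarith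
  let Ψ : (E → K) →ₗ[K]
      (Fin (Module.finrank K ((bernstein K n k).map π)) → (bernstein K n l).map π) :=
    Fintype.linearCombination K fun e j =>
      ⟨π (mono K (boxExp e.1) * p j * s ^ (e.2 : ℕ)), Submodule.mem_map_of_mem (hmem e j)⟩
  have hΨ : Function.Injective Ψ := by
    rw [injective_iff_map_eq_zero]
    intro c hc
    let Q : Fin m → D K n := fun i => ∑ a, c (a, i) • mono K (boxExp a)
    have hQ : ∀ i, Q i ∈ bernstein K n k := fun i =>
      sum_mem fun a _ => Submodule.smul_mem _ _ (mono_boxExp_mem a)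
    have hp0 : ∀ j, ∑ i, Q i * p j * s ^ (i : ℕ) ∈ J := by
      intro j
      have h := congrArg Subtype.val (congrFun hc j)
      simp only [Ψ, Fintype.linearCombination_apply, Finset.sum_apply, Pi.smul_apply,
        Submodule.coe_sum, Submodule.coe_smul, Pi.zero_apply, ZeroMemClass.coe_zero] at h
      rw [← hπ0, ← h]
      simp only [← map_smul, ← map_sum]
      congr 1
      rw [Fintype.sum_prod_type_right]
      refine Finset.sum_congr rfl fun i _ => ?_
      simp only [Q, Finset.sum_mul, smul_mul_assoc]
    -- Modulo `J` each `P` is a combination of the `p j`; the error stays in `J` because `J` is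
    -- stable under right multiplication by `s`.
    have hall : ∀ P ∈ bernstein K n k, ∑ i, Q i * P * s ^ (i : ℕ) ∈ J := by
      intro P hP
      let v : (bernstein K n k).map π := ⟨π P, Submodule.mem_map_of_mem hP⟩
      have hv : P - ∑ j, B.repr v j • p j ∈ J := by
        rw [← hπ0, map_sub, map_sum, sub_eq_zero]
        have := congrArg Subtype.val (B.sum_repr v)
        rw [Submodule.coe_sum] at this
        simp only [Submodule.coe_smul, ← hpB] at this
        simpa only [map_smul] using this.symm
      have e : ∑ i, Q i * P * s ^ (i : ℕ)
          = ∑ i, Q i * (P - ∑ j, B.repr v j • p j) * s ^ (i : ℕ)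
            + ∑ j, B.repr v j • ∑ i, Q i * p j * s ^ (i : ℕ) := by
        simp only [Finset.smul_sum]
        rw [Finset.sum_comm, ← Finset.sum_add_distrib]
        refine Finset.sum_congr rfl fun i _ => ?_
        rw [mul_sub, sub_mul, Finset.mul_sum _ _ (Q i), Finset.sum_mul _ _ (s ^ (i : ℕ))]
        simp only [mul_smul_comm, smul_mul_assoc]
        exact (sub_add_cancel _ _).symm
      rw [e]
      refine add_mem (sum_mem fun i _ => hJpow _ _ (J.mul_mem_left _ hv)) (sum_mem fun j _ => ?_)
      exact (J.restrictScalars K).smul_mem _ (hp0 j)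
    have hQ0 := eq_zero_of_sum_mul_pow_mem hJ k Q hQ hall
    have hli : LinearIndependent K (fun a => (mono K (boxExp (n := n) (m := m) a) : D K n)) :=
      linearIndependent_mono.comp _ boxExp_injective
    funext ⟨a, i⟩
    exact Fintype.linearIndependent_iff.1 hli (fun a => c (a, i)) (congrFun hQ0 i) a
  have h := LinearMap.finrank_le_finrank_of_injective hΨ
  rw [Module.finrank_fintype_fun_eq_card, Module.finrank_pi_fintype] at h
  simpa [E, hilbertFunction, hπ] using h

lemma exists_aeval_mem {J : Ideal (D K n)} {s : D K n}
    (hs : s ∈ bernstein K n 2) (hJs : ∀ P ∈ J, P * s ∈ J) {C : ℕ}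
    (hC : ∀ᶠ k in Filter.atTop, hilbertFunction J k ≤ C * k ^ n) :
    ∃ b : Polynomial K, b ≠ 0 ∧ Polynomial.aeval s b ∈ J := by
  by_contra! hJ
  obtain ⟨N, hN⟩ := Filter.eventually_atTop.1 hC
  set A := C * (2 * n + 1) ^ n * (C * (4 * n + 4) ^ n) with hA
  -- Large enough for both Hilbert function bounds, and larger than `A`, whereas the count forces `m
  -- ≤ A`.
  set m := N + A + 1 with hm
  have h := card_mul_le_hilbertFunction_mul hs hJs
    (fun b hb => by_contra fun h0 => hJ b h0 hb) m
  have h1 := hN ((2 * n + 1) * m) (by nlinarith)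
  have h2 := hN ((4 * n + 4) * m) (by nlinarith)
  have h3 : (m + 1) ^ n * (m + 1) ^ n * m ≤ A * (m ^ n * m ^ n) := by
    refine (h.trans (Nat.mul_le_mul h1 h2)).trans (le_of_eq ?_)
    rw [mul_pow, mul_pow, hA]
    ring
  have h4 : m ^ n * m ^ n * m ≤ (m + 1) ^ n * (m + 1) ^ n * m := by gcongr <;> omega
  have h5 : 0 < m ^ n * m ^ n := by positivity
  have h6 : m ^ n * m ^ n * m ≤ m ^ n * m ^ n * A := by linarith
  have := Nat.le_of_mul_le_mul_left h6 h5
  omega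

end Counting

/-! ### Growth of holonomic quotients; the action of `s` and of monomials on polynomials. -/

section Holonomic

variable {K : Type*} [Field K] {n : ℕ}

lemma IsHolonomic.exists_hilbertFunction_le {I : Ideal (D K n)} (hI : IsHolonomic I) :
    ∃ C : ℕ, ∀ᶠ k in Filter.atTop, hilbertFunction I k ≤ C * k ^ n := by
  rcases hI with rfl | ⟨p, hp, hpk⟩
  · refine ⟨0, Filter.Eventually.of_forall fun k => ?_⟩
    have : Subsingleton (D K n ⧸ (⊤ : Ideal (D K n))) := Submodule.Quotient.subsingleton_iff.2 rfl
    rw [hilbertFunction, Module.finrank_zero_of_subsingleton]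
    exact Nat.zero_le _
  · obtain ⟨C, hC⟩ := exists_nat_ge (∑ i ∈ Finset.range (n + 1), |p.coeff i|)
    refine ⟨C, ?_⟩
    filter_upwards [hpk, Filter.eventually_ge_atTop 1] with k hk hk1
    have hk1' : (1 : ℚ) ≤ k := by exact_mod_cast hk1
    have : (hilbertFunction I k : ℚ) ≤ C * (k : ℚ) ^ n := by
      rw [hk, Polynomial.eval_eq_sum_range, hp]
      calc ∑ i ∈ Finset.range (n + 1), p.coeff i * (k : ℚ) ^ i
          ≤ ∑ i ∈ Finset.range (n + 1), |p.coeff i| * (k : ℚ) ^ n := by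
            refine Finset.sum_le_sum fun i hi => ?_
            exact mul_le_mul (le_abs_self _)
              (pow_le_pow_right₀ hk1' (Nat.lt_succ_iff.1 (Finset.mem_range.1 hi)))
              (by positivity) (abs_nonneg _)
        _ = (∑ i ∈ Finset.range (n + 1), |p.coeff i|) * (k : ℚ) ^ n := by rw [Finset.sum_mul]
        _ ≤ C * (k : ℚ) ^ n := by gcongr
    exact_mod_cast this

lemma sOp_mem_bernstein (c : Fin n → K) : sOp c ∈ bernstein K n 2 :=
  Submodule.sum_mem _ fun i _ => Submodule.smul_mem _ (c i)
    (mul_mem_bernstein (k := 1) (l := 1) (x_mem_bernstein i) (d_mem_bernstein i))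

lemma sOp_apply (c : Fin n → K) (γ : Fin n →₀ ℕ) (a : K) :
    act (sOp c) (monomial γ a) = (∑ i, c i * γ i) • monomial γ a := by
  simp only [sOp, map_sum, map_smul, LinearMap.sum_apply, LinearMap.smul_apply, mul_apply',
    x_apply, d_apply, Finset.sum_smul]
  refine Finset.sum_congr rfl fun i _ => ?_
  rw [X_mul_pderiv_monomial, ← Nat.cast_smul_eq_nsmul K, smul_smul]

lemma mono_apply (m : (Fin n →₀ ℕ) × (Fin n →₀ ℕ)) (γ : Fin n →₀ ℕ) (a : K) :
    act (mono K m) (monomial γ a)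
      = monomial (m.1 + (γ - m.2)) (a * ∏ i, ((γ i).descFactorial (m.2 i) : K)) := by
  rw [mono, mul_apply', dPow_apply, xPow_apply, monomial_mul, one_mul]

end Holonomic

/-! ### Homogeneous operators and the gcd argument in `K[s]`. -/

section Homogeneous

variable {K : Type*} [Field K] {n : ℕ} {F : Subfield ℝ} (w : Fin n → F) (φ : F →+* K)

/-- The operator `s` attached to the weights. -/
noncomputable def weightOp : D K n := sOp fun i => φ (w i)

/-- Homogeneity of weight `u`, as an eigenvector condition for the commutator with `s`. -/
def IsHomog (u : F) (P : D K n) : Prop :=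
  P * weightOp w φ = weightOp w φ * P + φ u • P

variable {w φ}

lemma IsHomog.mul {u v : F} {P Q : D K n} (hP : IsHomog w φ u P) (hQ : IsHomog w φ v Q) :
    IsHomog w φ (u + v) (P * Q) := by
  unfold IsHomog at *
  rw [mul_assoc, hQ, mul_add, ← mul_assoc, hP, map_add, add_smul, add_mul, mul_assoc,
    mul_smul_comm, smul_mul_assoc, add_assoc]

variable (w φ) in
lemma isHomog_zero_aeval (p : Polynomial K) :
    IsHomog w φ 0 (Polynomial.aeval (weightOp w φ) p) := by
  unfold IsHomog
  rw [map_zero, zero_smul, add_zero]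
  simpa using congrArg (Polynomial.aeval (weightOp w φ)) (mul_comm p Polynomial.X)

lemma IsHomog.commute_aeval {P : D K n} (hP : IsHomog w φ 0 P)
    (p : Polynomial K) : Commute P (Polynomial.aeval (weightOp w φ) p) := by
  have h : Commute P (weightOp w φ) := by
    unfold IsHomog at hP
    rwa [map_zero, zero_smul, add_zero] at hP
  induction p using Polynomial.induction_on' with
  | add p q hp hq => rw [map_add]; exact hp.add_right hq
  | monomial i a =>
    rw [Polynomial.aeval_monomial]
    exact (Algebra.commute_algebraMap_right a P).mul_right (h.pow_right i)

/-- A left ideal that contains some `b(s) ≠ 0` and contains `p(s) - R q(s)`, for an `R` that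
commutes with `s`, contains some `r(s)` with `r` congruent to `p` modulo `q`. -/
lemma exists_dvd_sub {J : Ideal (D K n)} {b p q : Polynomial K}
    (hb : b ≠ 0) (hbJ : Polynomial.aeval (weightOp w φ) b ∈ J) {R : D K n}
    (hR : IsHomog w φ 0 R)
    (h : Polynomial.aeval (weightOp w φ) p - R * Polynomial.aeval (weightOp w φ) q ∈ J) :
    ∃ r : Polynomial K, q ∣ p - r ∧ Polynomial.aeval (weightOp w φ) r ∈ J := by
  set e := Polynomial.aeval (R := K) (weightOp w φ) with he
  let A : Ideal (Polynomial K) :=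
    { carrier := {f | e f ∈ J}
      add_mem' := fun {f g} hf hg => by
        simp only [Set.mem_ofPred_eq, map_add] at *; exact add_mem hf hg
      zero_mem' := by simp
      smul_mem' := fun c f hf => by
        simp only [Set.mem_ofPred_eq, smul_eq_mul, map_mul] at *; exact J.mul_mem_left _ hf }
  obtain ⟨g, hg⟩ := (IsPrincipalIdealRing.principal A).principal
  have hgA : ∀ f, e f ∈ J ↔ g ∣ f := fun f => by
    rw [← Ideal.mem_span_singleton, ← Ideal.submodule_span_eq, ← hg]; rfl
  -- This is where `b` is needed: `g ≠ 0` makes the cofactor `g'` cancellable below.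
  have hg0 : g ≠ 0 := fun h0 => hb (by simpa [h0] using (hgA b).1 hbJ)
  classical
  set c := EuclideanDomain.gcd g q with hc
  obtain ⟨g', hg'⟩ := EuclideanDomain.gcd_dvd_left g q
  obtain ⟨q', hq'⟩ := EuclideanDomain.gcd_dvd_right g q
  rw [← hc] at hg' hq'
  have hg'0 : g' ≠ 0 := fun h0 => hg0 (by rw [hg', h0, mul_zero])
  -- Since `g' q = q' g`, multiplying by `g'(s)` turns `R q(s)` into `R q'(s) g(s)`, a left multiple
  -- of `g(s) ∈ J`; moving `g'(s)` past `R` uses weight `0`.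
  have h1 : e (g' * p) ∈ J := by
    have e1 : e (g' * p) = e g' * (e p - R * e q) + R * e q' * e g := by
      have : e g' * (R * e q) = R * e q' * e g := by
        rw [← mul_assoc, ← (hR.commute_aeval g').eq, mul_assoc, mul_assoc, ← map_mul, ← map_mul,
          hq', hg']
        congr 2
        ring
      rw [mul_sub, this, map_mul, sub_add_cancel]
    rw [e1]
    exact add_mem (J.mul_mem_left _ h) (J.mul_mem_left _ ((hgA g).2 dvd_rfl))
  have h2 : c ∣ p := by
    rw [hgA, hg', mul_comm c] at h1
    exact (mul_dvd_mul_iff_left hg'0).1 h1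
  obtain ⟨t, ht⟩ := h2
  have hbez := EuclideanDomain.gcd_eq_gcd_ab g q
  rw [← hc] at hbez
  refine ⟨g * EuclideanDomain.gcdA g q * t, ⟨EuclideanDomain.gcdB g q * t, ?_⟩,
    (hgA _).2 ⟨EuclideanDomain.gcdA g q * t, mul_assoc _ _ _⟩⟩
  rw [ht]
  linear_combination t * hbez

end Homogeneous

/-! ### The weight grading of `D` and the ideal `gr^V(I)`. -/

section Grading

variable {K : Type*} [Field K] [CharZero K] {n : ℕ} {F : Subfield ℝ}

lemma monoBasis_apply (m : (Fin n →₀ ℕ) × (Fin n →₀ ℕ)) : monoBasis K n m = mono K m :=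
  Module.Basis.mk_apply _ _ _

/-- The weight of an exponent, as an element of the field generated by the weights. -/
noncomputable def fieldWeight (w : Fin n → F) (m : (Fin n →₀ ℕ) × (Fin n →₀ ℕ)) : F :=
  -(∑ i, w i * m.1 i) + ∑ i, w i * m.2 i

lemma weight_coe (w : Fin n → F) (m : (Fin n →₀ ℕ) × (Fin n →₀ ℕ)) :
    weight (fun i => (w i : ℝ)) m = fieldWeight w m := by
  simp [weight, fieldWeight]

open Classical in
/-- The projection to the component of weight `u`. -/
noncomputable def component (K : Type*) [Field K] [CharZero K] (w : Fin n → F) (u : F) :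
    D K n →ₗ[K] D K n :=
  (monoBasis K n).constr K fun m => if fieldWeight w m = u then mono K m else 0

variable (w : Fin n → F) (φ : F →+* K)

open Classical in
lemma component_mono (u : F) (m : (Fin n →₀ ℕ) × (Fin n →₀ ℕ)) :
    component K w u (mono K m) = if fieldWeight w m = u then mono K m else 0 := by
  rw [component, ← monoBasis_apply, Module.Basis.constr_basis, monoBasis_apply]

open Classical in
lemma component_eq_sum (u : F) (P : D K n) :
    component K w u P = ∑ m ∈ ((monoBasis K n).repr P).support with fieldWeight w m = u,
      (monoBasis K n).repr P m • mono K m := by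
  rw [component, Module.Basis.constr_apply, Finsupp.sum, Finset.sum_filter]
  refine Finset.sum_congr rfl fun m _ => ?_
  split_ifs <;> simp

open Classical in
lemma repr_component (u : F) (P : D K n) (m : (Fin n →₀ ℕ) × (Fin n →₀ ℕ)) :
    (monoBasis K n).repr (component K w u P) m
      = if fieldWeight w m = u then (monoBasis K n).repr P m else 0 := by
  rw [component_eq_sum, map_sum, Finsupp.finsetSum_apply]
  simp only [map_smul, ← monoBasis_apply, Module.Basis.repr_self, Finsupp.smul_apply, smul_eq_mul,
    Finsupp.single_apply, mul_ite, mul_one, mul_zero, Finset.sum_ite_eq', Finset.mem_filter,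
    Finsupp.mem_support_iff]
  split_ifs with h1 h2 h2
  · rfl
  · exact absurd h1.2 h2
  · exact (not_not.1 fun h => h1 ⟨h, h2⟩).symm
  · rfl

/-- The polynomial `x^γ` is an eigenvector of `s` with eigenvalue `∑ w_i γ_i`, and `x^α ∂^β` shifts
`γ` by `α - β` or, when `β ≰ γ`, kills it. -/
lemma mono_mul_weightOp (m : (Fin n →₀ ℕ) × (Fin n →₀ ℕ)) :
    mono K m * weightOp w φ = weightOp w φ * mono K m + φ (fieldWeight w m) • mono K m := by
  refine D_ext fun γ a => ?_
  rw [map_add, map_smul, LinearMap.add_apply, LinearMap.smul_apply, mul_apply', mul_apply',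
    weightOp, sOp_apply, map_smul, mono_apply, sOp_apply, ← add_smul]
  by_cases h : m.2 ≤ γ
  · congr 1
    simp only [fieldWeight, map_add, map_neg, map_sum, map_mul, map_natCast]
    rw [neg_add_eq_sub, ← Finset.sum_sub_distrib, ← Finset.sum_add_distrib]
    refine Finset.sum_congr rfl fun i _ => ?_
    rw [Finsupp.add_apply, Finsupp.tsub_apply, Nat.cast_add, Nat.cast_sub (h i)]
    ring
  · obtain ⟨i, hi⟩ := not_forall.1 h
    have : ∏ i, ((γ i).descFactorial (m.2 i) : K) = 0 :=
      Finset.prod_eq_zero (Finset.mem_univ i)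
        (by rw [Nat.descFactorial_of_lt (not_le.1 hi), Nat.cast_zero])
    simp [this]

variable {w φ}

lemma isHomog_mono (m : (Fin n →₀ ℕ) × (Fin n →₀ ℕ)) :
    IsHomog w φ (fieldWeight w m) (mono K m) := mono_mul_weightOp w φ m

variable (w φ) in
lemma repr_commutator (P : D K n) (m : (Fin n →₀ ℕ) × (Fin n →₀ ℕ)) :
    (monoBasis K n).repr (P * weightOp w φ - weightOp w φ * P) m
      = φ (fieldWeight w m) * (monoBasis K n).repr P m := by
  have : (Finsupp.lapply m ∘ₗ (monoBasis K n).repr.toLinearMap) ∘ₗ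
      (LinearMap.mulRight K (weightOp w φ) - LinearMap.mulLeft K (weightOp w φ))
      = φ (fieldWeight w m) • (Finsupp.lapply m ∘ₗ (monoBasis K n).repr.toLinearMap) := by
    refine (monoBasis K n).ext fun m' => ?_
    have e : mono K m' * weightOp w φ - weightOp w φ * mono K m'
        = φ (fieldWeight w m') • monoBasis K n m' := by
      rw [mono_mul_weightOp, add_sub_cancel_left, monoBasis_apply]
    simp only [LinearMap.comp_apply, LinearMap.sub_apply, LinearMap.mulRight_apply,
      LinearMap.mulLeft_apply, LinearMap.smul_apply]
    rw [monoBasis_apply, e, ← monoBasis_apply]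
    by_cases h : m' = m
    · subst h; simp
    · simp [Finsupp.single_eq_of_ne' h]
  exact LinearMap.congr_fun this P

/-- The commutator with `s` is diagonal in the monomial basis, and `φ` is injective, so distinct
weights give distinct eigenvalues in `K`. -/
lemma IsHomog.repr_eq_zero {u : F} {P : D K n} (hP : IsHomog w φ u P)
    {m : (Fin n →₀ ℕ) × (Fin n →₀ ℕ)} (h : fieldWeight w m ≠ u) :
    (monoBasis K n).repr P m = 0 := by
  have h1 := repr_commutator w φ P m
  rw [sub_eq_of_eq_add' hP, map_smul, Finsupp.smul_apply, smul_eq_mul, ← sub_eq_zero, ← sub_mul]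
    at h1
  exact (mul_eq_zero.1 h1).resolve_left (sub_ne_zero.2 (φ.injective.ne h.symm))

lemma IsHomog.component_self {u : F} {P : D K n} (hP : IsHomog w φ u P) :
    component K w u P = P := by
  refine (monoBasis K n).ext_elem fun m => ?_
  rw [repr_component]
  split_ifs with h
  · rfl
  · exact (hP.repr_eq_zero h).symm

lemma IsHomog.component_of_ne {u v : F} {P : D K n} (hP : IsHomog w φ u P) (h : u ≠ v) :
    component K w v P = 0 := by
  refine (monoBasis K n).ext_elem fun m => ?_
  rw [repr_component, map_zero, Finsupp.zero_apply]
  split_ifs with hm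
  · exact hP.repr_eq_zero (hm.trans_ne h.symm)
  · rfl

variable (w φ) in
lemma isHomog_component (u : F) (P : D K n) : IsHomog w φ u (component K w u P) := by
  refine eq_add_of_sub_eq' ((monoBasis K n).ext_elem fun m => ?_)
  rw [repr_commutator, map_smul, Finsupp.smul_apply, smul_eq_mul, repr_component]
  split_ifs with h
  · rw [h]
  · simp

lemma component_mul_left {a : F} {A : D K n} (hA : IsHomog w φ a A) (u : F) (P : D K n) :
    component K w (a + u) (A * P) = A * component K w u P := by
  have : component K w (a + u) ∘ₗ LinearMap.mulLeft K A
      = LinearMap.mulLeft K A ∘ₗ component K w u := by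
    refine (monoBasis K n).ext fun m => ?_
    rw [monoBasis_apply, LinearMap.comp_apply, LinearMap.comp_apply, LinearMap.mulLeft_apply,
      LinearMap.mulLeft_apply]
    by_cases h : fieldWeight w m = u
    · rw [← h, (hA.mul (isHomog_mono m)).component_self, (isHomog_mono (φ := φ) m).component_self]
    · rw [(hA.mul (isHomog_mono m)).component_of_ne (by simpa using h),
        (isHomog_mono (φ := φ) m).component_of_ne h, mul_zero]
  exact LinearMap.congr_fun this P

lemma component_mul_right {a : F} {A : D K n} (hA : IsHomog w φ a A) (u : F) (P : D K n) :
    component K w (u + a) (P * A) = component K w u P * A := by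
  have : component K w (u + a) ∘ₗ LinearMap.mulRight K A
      = LinearMap.mulRight K A ∘ₗ component K w u := by
    refine (monoBasis K n).ext fun m => ?_
    rw [monoBasis_apply, LinearMap.comp_apply, LinearMap.comp_apply, LinearMap.mulRight_apply,
      LinearMap.mulRight_apply]
    by_cases h : fieldWeight w m = u
    · rw [← h, ((isHomog_mono m).mul hA).component_self, (isHomog_mono (φ := φ) m).component_self]
    · rw [((isHomog_mono m).mul hA).component_of_ne (by simpa using h),
        (isHomog_mono (φ := φ) m).component_of_ne h, zero_mul]
  exact LinearMap.congr_fun this P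

variable (w)

lemma fieldWeight_le_of_component_eq_zero {t : F} {P : D K n}
    (h : ∀ v, t < v → component K w v P = 0) {m : (Fin n →₀ ℕ) × (Fin n →₀ ℕ)}
    (hm : (monoBasis K n).repr P m ≠ 0) : fieldWeight w m ≤ t := by
  by_contra! hlt
  have h1 := repr_component w (fieldWeight w m) P m
  rw [h _ hlt, if_pos rfl, map_zero, Finsupp.zero_apply] at h1
  exact hm h1.symm

lemma symbol_eq_component {t : F} {P : D K n} (h : ∀ v, t < v → component K w v P = 0)
    (hne : component K w t P ≠ 0) : symbol (fun i => (w i : ℝ)) P = component K w t P := by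
  classical
  rw [component_eq_sum] at hne
  obtain ⟨m₀, hm₀, -⟩ := Finset.exists_ne_zero_of_sum_ne_zero hne
  rw [Finset.mem_filter] at hm₀
  rw [component_eq_sum, symbol]
  refine Finset.sum_congr (Finset.filter_congr fun m hm => ?_) fun _ _ => rfl
  simp only [weight_coe, Subtype.coe_le_coe]
  have hle := fun m' hm' => fieldWeight_le_of_component_eq_zero w h (m := m')
    (Finsupp.mem_support_iff.1 hm')
  constructor
  · intro h'
    exact le_antisymm (hle m hm) (hm₀.2 ▸ h' m₀ hm₀.1)
  · intro e m' hm'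
    exact e ▸ hle m' hm'

lemma exists_symbol_eq (P : D K n) : ∃ u, symbol (fun i => (w i : ℝ)) P = component K w u P ∧
    (∀ v, u < v → component K w v P = 0) ∧ (component K w u P = 0 → P = 0) := by
  classical
  by_cases hP : P = 0
  · subst hP
    exact ⟨0, by simp [symbol], by simp, fun _ => rfl⟩
  have hs : ((monoBasis K n).repr P).support.Nonempty := by
    rw [Finsupp.support_nonempty_iff]
    simpa using hP
  obtain ⟨m₀, hm₀, hmax⟩ := Finset.exists_max_image _ (fieldWeight w) hs
  have h1 : ∀ v, fieldWeight w m₀ < v → component K w v P = 0 := by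
    intro v hv
    rw [component_eq_sum, Finset.filter_false_of_mem, Finset.sum_empty]
    intro m hm e
    exact (hmax m hm).not_gt (e ▸ hv)
  have h2 : component K w (fieldWeight w m₀) P ≠ 0 := by
    intro h0
    have := repr_component w (fieldWeight w m₀) P m₀
    rw [h0, if_pos rfl, map_zero, Finsupp.zero_apply] at this
    exact Finsupp.mem_support_iff.1 hm₀ this.symm
  exact ⟨_, symbol_eq_component w h1 h2, h1, fun h => absurd h h2⟩

/-- The bound `t` need not be attained: the component is then `0`. Hence `mul_mem_gr` does not need
to know that a product of symbols is nonzero. -/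
lemma component_mem_gr {I : Ideal (D K n)} {P : D K n} (hP : P ∈ I) {t : F}
    (h : ∀ v, t < v → component K w v P = 0) :
    component K w t P ∈ gr (fun i => (w i : ℝ)) I := by
  by_cases h0 : component K w t P = 0
  · rw [h0]; exact zero_mem _
  · rw [← symbol_eq_component w h h0]
    exact Submodule.subset_span ⟨P, hP, rfl⟩

lemma mul_mem_gr (φ : F →+* K) {I : Ideal (D K n)} (A : D K n) {G : D K n}
    (hG : G ∈ gr (fun i => (w i : ℝ)) I) : A * G ∈ gr (fun i => (w i : ℝ)) I := by
  have hA : A ∈ Submodule.span K (Set.range (mono K : _ → D K n)) := by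
    rw [span_mono]; trivial
  induction hA using Submodule.span_induction with
  | zero => simp
  | add A B _ _ hA hB => rw [add_mul]; exact add_mem hA hB
  | smul c A _ hA => rw [smul_mul_assoc]; exact Submodule.smul_mem _ _ hA
  | mem A h =>
    obtain ⟨m, rfl⟩ := h
    have hm := isHomog_mono (w := w) (φ := φ) m
    induction hG using Submodule.span_induction with
    | zero => simp
    | add A B _ _ hA hB => rw [mul_add]; exact add_mem hA hB
    | smul c A _ hA => rw [mul_smul_comm]; exact Submodule.smul_mem _ _ hA
    | mem G h =>
      obtain ⟨P, hP, rfl⟩ := h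
      obtain ⟨u, hu, hv, -⟩ := exists_symbol_eq w P
      rw [hu, ← component_mul_left hm]
      refine component_mem_gr w (I.mul_mem_left _ hP) fun v h => ?_
      rw [← add_sub_cancel (fieldWeight w m) v, component_mul_left hm, hv _ (lt_sub_iff_add_lt'.2 h),
        mul_zero]

/-- `gr^V(I)` as a left ideal. -/
noncomputable def grIdeal (φ : F →+* K) (I : Ideal (D K n)) : Ideal (D K n) where
  carrier := gr (fun i => (w i : ℝ)) I
  add_mem' := add_mem
  zero_mem' := zero_mem _
  smul_mem' A _ hG := mul_mem_gr w φ A hG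

lemma mul_weightOp_mem_gr (φ : F →+* K) {I : Ideal (D K n)} {G : D K n}
    (hG : G ∈ gr (fun i => (w i : ℝ)) I) :
    G * weightOp w φ ∈ gr (fun i => (w i : ℝ)) I := by
  induction hG using Submodule.span_induction with
  | zero => simp
  | add A B _ _ hA hB => rw [add_mul]; exact add_mem hA hB
  | smul c A _ hA => rw [smul_mul_assoc]; exact Submodule.smul_mem _ _ hA
  | mem G h =>
    have hG : G ∈ gr (fun i => (w i : ℝ)) I := Submodule.subset_span h
    obtain ⟨P, hP, rfl⟩ := h
    obtain ⟨u, hu, -⟩ := exists_symbol_eq w P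
    have h1 : IsHomog w φ u (symbol (fun i => (w i : ℝ)) P) := hu ▸ isHomog_component w φ u P
    rw [h1]
    exact add_mem (mul_mem_gr w φ _ hG) (Submodule.smul_mem _ _ hG)

lemma component_gr_mem_gr (φ : F →+* K) {I : Ideal (D K n)} {G : D K n}
    (hG : G ∈ gr (fun i => (w i : ℝ)) I) (v : F) :
    component K w v G ∈ gr (fun i => (w i : ℝ)) I := by
  induction hG using Submodule.span_induction with
  | zero => simp
  | add A B _ _ hA hB => rw [map_add]; exact add_mem hA hB
  | smul c A _ hA => rw [map_smul]; exact Submodule.smul_mem _ _ hA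
  | mem G h =>
    have hG : G ∈ gr (fun i => (w i : ℝ)) I := Submodule.subset_span h
    obtain ⟨P, hP, rfl⟩ := h
    obtain ⟨u, hu, -⟩ := exists_symbol_eq w P
    have h1 : IsHomog w φ u (symbol (fun i => (w i : ℝ)) P) := hu ▸ isHomog_component w φ u P
    by_cases h : u = v
    · rw [← h, h1.component_self]; exact hG
    · rw [h1.component_of_ne h]; exact zero_mem _

/-- Standard monomials: choose monomials in `F_k` that form a basis modulo `gr^V(I)`. They are
independent modulo `I`, because the symbol of a combination lying in `I` is a combination of the
same monomials lying in `gr^V(I)`, so it vanishes, and with it the whole combination. -/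
lemma hilbertFunction_grIdeal_le (φ : F →+* K) (I : Ideal (D K n)) (k : ℕ) :
    hilbertFunction (grIdeal w φ I) k ≤ hilbertFunction I k := by
  classical
  let S : Set ((Fin n →₀ ℕ) × (Fin n →₀ ℕ)) := {m | (∑ i, m.1 i) + ∑ i, m.2 i ≤ k}
  let π (J : Ideal (D K n)) : D K n →ₗ[K] (D K n ⧸ J) := J.mkQ.restrictScalars K
  have hπ : ∀ J P, π J P = 0 ↔ P ∈ J := fun J P => Submodule.Quotient.mk_eq_zero J
  have hspan : ∀ J, (bernstein K n k).map (π J)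
      = Submodule.span K (Set.range fun m : S => π J (mono K (m : _ × _))) := by
    intro J
    rw [bernstein, Submodule.map_span, ← Set.image_comp, Set.image_eq_range]
    rfl
  obtain ⟨κ, a, ha, hsp, hli⟩ := exists_linearIndependent' K
    fun m : S => π (grIdeal w φ I) (mono K (m : _ × _))
  have hmono : LinearIndependent K fun j => (mono K (a j : _ × _) : D K n) :=
    linearIndependent_mono.comp _ (Subtype.val_injective.comp ha)
  have hfin : Finite κ := by
    have hb : ∀ j, (mono K (a j : _ × _) : D K n) ∈ bernstein K n k :=
      fun j => mono_mem_bernstein (a j).2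
    have : LinearIndependent K fun j => (⟨_, hb j⟩ : bernstein K n k) :=
      LinearIndependent.of_comp (bernstein K n k).subtype hmono
    exact this.finite
  have := Fintype.ofFinite κ
  have hI : LinearIndependent K fun j => π I (mono K (a j : _ × _)) := by
    rw [Fintype.linearIndependent_iff]
    intro g hg
    simp only [← map_smul, ← map_sum] at hg
    rw [hπ] at hg
    obtain ⟨u, hu, -, h0⟩ := exists_symbol_eq w (∑ j, g j • (mono K (a j : _ × _) : D K n))
    have hmem : component K w u (∑ j, g j • (mono K (a j : _ × _) : D K n)) ∈ grIdeal w φ I := by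
      rw [← hu]
      exact Submodule.subset_span ⟨_, hg, rfl⟩
    have hcomp : component K w u (∑ j, g j • (mono K (a j : _ × _) : D K n))
        = ∑ j, (if fieldWeight w (a j) = u then g j else 0) • mono K (a j : _ × _) := by
      rw [map_sum]
      refine Finset.sum_congr rfl fun j _ => ?_
      rw [map_smul, component_mono]
      split_ifs <;> simp
    rw [← hπ, hcomp, map_sum] at hmem
    simp only [map_smul] at hmem
    have h1 := Fintype.linearIndependent_iff.1 hli _ hmem
    refine Fintype.linearIndependent_iff.1 hmono g (h0 ?_)
    rw [hcomp]
    exact Finset.sum_eq_zero fun j _ => by rw [h1 j, zero_smul]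
  change Module.finrank K ((bernstein K n k).map (π (grIdeal w φ I)))
    ≤ Module.finrank K ((bernstein K n k).map (π I))
  rw [hspan, ← hsp, finrank_span_eq_card hli, ← finrank_span_eq_card hI]
  refine Submodule.finrank_mono (Submodule.span_le.2 ?_)
  rintro _ ⟨j, rfl⟩
  exact Submodule.mem_map_of_mem (mono_mem_bernstein (a j).2)

lemma exists_aeval_mem_gr (φ : F →+* K) {I : Ideal (D K n)} (hI : IsHolonomic I) :
    ∃ b : Polynomial K, b ≠ 0 ∧
      Polynomial.aeval (weightOp w φ) b ∈ gr (fun i => (w i : ℝ)) I := by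
  obtain ⟨C, hC⟩ := hI.exists_hilbertFunction_le
  exact exists_aeval_mem (J := grIdeal w φ I) (sOp_mem_bernstein _)
    (fun P hP => mul_weightOp_mem_gr w φ hP)
    (hC.mono fun k hk => (hilbertFunction_grIdeal_le w φ I k).trans hk)

end Grading

end Weyl

theorem proposition2p11 {K : Type*} [Field K] [CharZero K] {n : ℕ}
    -- a subfield of the reals that contains the weights, and a copy of it in `K`
    (F : Subfield ℝ) (φ : F →+* K)
    (w : Fin n → F) (hw : ∀ i, 0 ≤ w i) (hw0 : w ≠ 0)
    (I : Ideal (Weyl.D K n)) (hI : Weyl.IsHolonomic I)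
    (s : Weyl.D K n) (hs : s = Weyl.sOp (fun i => φ (w i)))
    (q : Polynomial K) :
    (Weyl.gr (fun i => (w i : ℝ)) I
          ⊔ (Ideal.span {Polynomial.aeval s q}).restrictScalars K)
        ⊓ Weyl.polys s
      = (Weyl.gr (fun i => (w i : ℝ)) I ⊓ Weyl.polys s)
        ⊔ Weyl.polyMultiples s (Polynomial.aeval s q) := by
  have hs' : s = Weyl.weightOp w φ := hs
  subst hs'
  apply le_antisymm
  · rintro _ ⟨hP, p, rfl⟩
    obtain ⟨G, hG, T, hT, e⟩ := Submodule.mem_sup.1 hP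
    obtain ⟨R, rfl⟩ := Ideal.mem_span_singleton'.1 hT
    obtain ⟨b, hb, hbJ⟩ := Weyl.exists_aeval_mem_gr w φ hI
    -- The component of weight `0` of `p(s) = G + R q(s)`: `p(s)` is unchanged, and `R` is replaced
    -- by its own component of weight `0`.
    have h0 := congrArg (Weyl.component K w 0) e
    have hR := Weyl.component_mul_right (Weyl.isHomog_zero_aeval w φ q) 0 R
    rw [add_zero] at hR
    rw [map_add, hR, AlgHom.toLinearMap_apply, (Weyl.isHomog_zero_aeval w φ p).component_self] at h0
    obtain ⟨r, ⟨t, ht⟩, hr⟩ := Weyl.exists_dvd_sub (J := Weyl.grIdeal w φ I) hb hbJ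
      (Weyl.isHomog_component w φ 0 R) (p := p) (q := q) (by
        rw [← h0, add_sub_cancel_right]
        exact Weyl.component_gr_mem_gr w φ hG 0)
    rw [AlgHom.toLinearMap_apply, ← add_sub_cancel r p, ht, map_add]
    refine Submodule.add_mem_sup ⟨hr, r, rfl⟩ ⟨_, ⟨t, rfl⟩, ?_⟩
    rw [LinearMap.mulRight_apply, AlgHom.toLinearMap_apply, ← map_mul, mul_comm]
  · refine sup_le (inf_le_inf_right _ le_sup_left) ?_
    rintro _ ⟨_, ⟨t, rfl⟩, rfl⟩
    refine ⟨Submodule.mem_sup_right ?_, t * q, ?_⟩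
    · exact Ideal.mul_mem_left _ _ (Ideal.mem_span_singleton_self _)
    · simp
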